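/- Notation. Multi-indices are $i\in\mathbb N_0^3$ with $|i|=i_1+i_2+i_3$; $\gamma\le\beta$ is meant componentwise, and $\gamma<\beta$ means $\gamma\le\beta$, $\gamma\ne\beta$; $e_1,e_2,e_3$ are the unit multi-indices. For $f$ smooth at $x_C\in\mathbb R^3$ put $T_f[\beta]=\frac1{\beta!}\partial_x^\beta f(x_C)$. Hypothesis on the operator. Let $x_C\in\mathbb R^3$ and let $c=\{c_i: i\in\mathbb N_0^3,|i|\le 2\}$ be complex-valued functions (the coefficients of $\mathcal L_c=\sum_{|i|\le2}c_i\,\partial_x^i$) that are $C^\infty$ at $x_C$, with $c_{2e_1}(x_C)\ne0$, and such that the symmetric $3\times3$ matrix $\mathcal C$ with entries $\mathcal C_{kk}=c_{2e_k}(x_C)$ and $\mathcal C_{kk'}=\frac12c_{e_k+e_{k'}}(x_C)$ ($k\ne k'$) is real and non-singular. Let $\mathcal C=\mathcal P\mathcal D\mathcal P^T$ with $\mathcal P$ real orthogonal and $\mathcal D$ real, diagonal and non-singular, and let $\mathcal D^{-1/2}$ be any complex diagonal matrix whose square is $\mathcal D^{-1}$. Generalized plane waves (GPWs). Let $q\ge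 1$ and $\Lambda\in\mathbb C^3$. (a) Amplitude-based: $J_\Lambda(x)=Q(x-x_C)\exp(\Lambda\cdot(x-x_C))$ with $Q=\sum_{|i|\le q+1}\mu_iX^i$, where $\mu_{\mathbf 0}=1$, $\mu_{e_k}=0$, $\mu_i=0$ for $2\le|i|\le q+1$ with $i_1\in\{0,1\}$, and the remaining coefficients are computed for $\ell=0,\dots,q-1$ successively: for $|\beta|=\ell$, in order of increasing $\beta_1$, $$\mu_{\beta+2e_1}=\frac{1}{(\beta_1+2)(\beta_1+1)T_{c_{2e_1}}[\mathbf 0]}\Big(\mathsf B_\beta-\sum_{k=2}^3(\beta_k+2)(\beta_k+1)T_{c_{2e_k}}[\mathbf 0]\mu_{\beta+2e_k}-\sum_{1\le k<k'\le3}(\beta_k+1)(\beta_{k'}+1)T_{c_{e_k+e_{k'}}}[\mathbf 0]\mu_{\beta+e_k+e_{k'}}\Big),\qquad(*)$$ $$\begin{aligned}\mathsf B_\beta=&-\sum_{\gamma<\beta}\Big(\sum_{k}T_{c_{2e_k}}[\beta-\gamma](\gamma_k+2)(\gamma_k+1)\mu_{\gamma+2e_k}+\sum_{k<k'}T_{c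_{e_k+e_{k'}}}[\beta-\gamma](\gamma_k+1)(\gamma_{k'}+1)\mu_{\gamma+e_k+e_{k'}}\Big)\\&-\sum_{\gamma\le\beta}\Big(\sum_kT_{c_{2e_k}}[\beta-\gamma]\big(2\Lambda_k(\gamma_k+1)\mu_{\gamma+e_k}+\Lambda_k^2\mu_\gamma\big)\\&\qquad+\sum_{k<k'}T_{c_{e_k+e_{k'}}}[\beta-\gamma]\big(\Lambda_k(\gamma_{k'}+1)\mu_{\gamma+e_{k'}}+\Lambda_{k'}(\gamma_k+1)\mu_{\gamma+e_k}+\Lambda_k\Lambda_{k'}\mu_\gamma\big)\\&\qquad+\sum_kT_{c_{e_k}}[\beta-\gamma]\big((\gamma_k+1)\mu_{\gamma+e_k}+\Lambda_k\mu_\gamma\big)+T_{c_{\mathbf 0}}[\beta-\gamma]\mu_\gamma\Big).\end{aligned}$$ (b) Phase-based: $G_\Lambda(x)=\exp P(x-x_C)$ with $P=\sum_{|i|\le q+1}\lambda_iX^i$, where $\lambda_{\mathbf 0}=0$, $\lambda_{e_k}=\Lambda_k$, $\lambda_i=0$ for $2\le|i|\le q+1$ with $i_1\in\{0,1\}$,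 and the remaining coefficients are computed in the same order by $(*)$ with $\lambda$ in place of $\mu$ and $$\begin{aligned}\mathsf B_\beta=&-\sum_{\gamma<\beta}\Big(\sum_{k}T_{c_{2e_k}}[\beta-\gamma](\gamma_k+2)(\gamma_k+1)\lambda_{\gamma+2e_k}+\sum_{k<k'}T_{c_{e_k+e_{k'}}}[\beta-\gamma](\gamma_k+1)(\gamma_{k'}+1)\lambda_{\gamma+e_k+e_{k'}}\Big)\\&-\sum_{\gamma\le\beta}\Big(\sum_kT_{c_{2e_k}}[\beta-\gamma]\sum_{\eta\le\gamma}(\gamma_k-\eta_k+1)\lambda_{\gamma-\eta+e_k}(\eta_k+1)\lambda_{\eta+e_k}\\&\qquad+\sum_{k<k'}T_{c_{e_k+e_{k'}}}[\beta-\gamma]\sum_{\eta\le\gamma}(\gamma_{k'}-\eta_{k'}+1)\lambda_{\gamma-\eta+e_{k'}}(\eta_k+1)\lambda_{\eta+e_k}+\sum_kT_{c_{e_k}}[\beta-\gamma](\gamma_k+1)\lambda_{\gamma+e_k}\Big)-T_{c_{\mathbf 0}}[\beta].\end{aligned}$$ Statement. Let $n\ge1$ be an integer and $q=\max(n-1,1)$,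 and let the hypothesis above hold. Consider the $(n+1)^2$ directions $$\mathbf d_{l,m}=(\sin\theta_l\cos\varphi_{lm},\ \sin\theta_l\sin\varphi_{lm},\ \cos\theta_l),\qquad 0\le l\le n,\ |m|\le l,$$ where $\theta_0,\dots,\theta_n\in(0,\pi)$ are pairwise distinct and the $\varphi_{lm}\in[0,2\pi)$ satisfy $\varphi_{lm}\ne\varphi_{lm'}$ whenever $m\ne m'$. Let $\mathfrak s\in\mathbb C\setminus\{0\}$ and $\Lambda_{l,m}=\mathfrak s\,\mathcal P\mathcal D^{-1/2}\mathbf d_{l,m}\in\mathbb C^3$. Then the matrices $$\mathsf A^{[n]}=\big(T_{J_{\Lambda_{l,m}}}[i]\big)_{|i|\le n;\ 0\le l\le n,\,|m|\le l},\qquad \mathsf P^{[n]}=\big(T_{G_{\Lambda_{l,m}}}[i]\big)_{|i|\le n;\ 0\le l\le n,\,|m|\le l},$$ which are of size $\frac{(n+1)(n+2)(n+3)}6\times(n+1)^2$, both have rank $(n+1)^2$. -/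

import Mathlib

noncomputable section

namespace GPW

/-! ## Multi-indices, partial derivatives, Taylor coefficients -/

/-- Multi-indices of three non-negative integers; the order `≤` is componentwise, and `γ < β` means
`γ ≤ β` and `γ ≠ β`. The coordinates `1, 2, 3` are numbered `0, 1, 2` here. -/
abbrev MultiIndex := Fin 3 → ℕ

/-- The space `ℝ³`. -/
abbrev Space := EuclideanSpace ℝ (Fin 3)

/-- The multi-index `e_k`. -/
def e (k : Fin 3) : MultiIndex := Pi.single k 1

/-- The length `|i| = i₁ + i₂ + i₃`. -/
def length (i : MultiIndex) : ℕ := ∑ k, i k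

/-- The multi-indices of length at most `d`. -/
def indicesUpTo (d : ℕ) : Finset MultiIndex :=
  (Finset.Iic (fun _ => d : MultiIndex)).filter (fun i => length i ≤ d)

/-- `i! = i₁! i₂! i₃!`. -/
def multiFactorial (i : MultiIndex) : ℕ := ∏ k, (i k).factorial

/-- The partial derivative `∂_{x_k} f`. -/
def partialDeriv (k : Fin 3) (f : Space → ℂ) : Space → ℂ :=
  fun x => fderiv ℝ f x (EuclideanSpace.single k 1)

/-- `∂^i f = ∂_{x₁}^{i₁} ∂_{x₂}^{i₂} ∂_{x₃}^{i₃} f`. -/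
def multiDeriv (i : MultiIndex) (f : Space → ℂ) : Space → ℂ :=
  (partialDeriv 0)^[i 0] ((partialDeriv 1)^[i 1] ((partialDeriv 2)^[i 2] f))

/-- The Taylor coefficient `T_f[i] = ∂^i f (x_C) / i!`. -/
def taylor (xC : Space) (f : Space → ℂ) (i : MultiIndex) : ℂ :=
  multiDeriv i f xC / (multiFactorial i : ℂ)

/-! ## The differential operator `∑_{|i| ≤ 2} c_i(x) ∂^i` and the hypothesis on it -/

/-- The symmetric matrix of the second-order coefficients at `x_C`: the diagonal entries are
`c_{2e_k}(x_C)`, the off-diagonal ones `c_{e_j+e_k}(x_C) / 2`. -/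
def principalMatrix (xC : Space) (c : MultiIndex → Space → ℂ) : Matrix (Fin 3) (Fin 3) ℂ :=
  Matrix.of fun j k => if j = k then c (2 • e k) xC else c (e j + e k) xC / 2

/-- The hypothesis on the coefficients `c_i`, `|i| ≤ 2` (the values of `c` at longer multi-indices
are never used). -/
structure OperatorHypothesis (xC : Space) (c : MultiIndex → Space → ℂ) : Prop where
  smooth : ∀ i, length i ≤ 2 → ContDiffAt ℝ (⊤ : ℕ∞) (c i) xC
  coeff_ne_zero : c (2 • e 0) xC ≠ 0
  nonsingular : (principalMatrix xC c).det ≠ 0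

/-- `P` is a real orthogonal matrix and `D` the diagonal of a real non-singular diagonal matrix such
that the matrix of second-order coefficients is `P D Pᵀ`. (Such `P` and `D` exist exactly when that
matrix is real and non-singular.) -/
structure IsEigenDecomposition (xC : Space) (c : MultiIndex → Space → ℂ)
    (P : Matrix (Fin 3) (Fin 3) ℝ) (D : Fin 3 → ℝ) : Prop where
  orthogonal : P ∈ Matrix.orthogonalGroup (Fin 3) ℝ
  diag_ne_zero : ∀ k, D k ≠ 0
  eq : principalMatrix xC c = (P * Matrix.diagonal D * P.transpose).map Complex.ofReal

/-! ## Solution of one layer of equations by substitution -/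

/-- Auxiliary form of `solveSubsystem` with the three components of the multi-index as separate
arguments: the recursion is on the first component. -/
def solveSubsystemAux (t fixed B : MultiIndex → ℂ) : ℕ → ℕ → ℕ → ℂ
  | 0, b₂, b₃ => fixed ![0, b₂, b₃]
  | 1, b₂, b₃ => fixed ![1, b₂, b₃]
  | b₁ + 2, b₂, b₃ =>
      1 / (((b₁ : ℂ) + 2) * ((b₁ : ℂ) + 1) * t (2 • e 0)) *
        (B ![b₁, b₂, b₃]
          - (((b₂ : ℂ) + 2) * ((b₂ : ℂ) + 1) * t (2 • e 1)
                * solveSubsystemAux t fixed B b₁ (b₂ + 2) b₃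
              + ((b₃ : ℂ) + 2) * ((b₃ : ℂ) + 1) * t (2 • e 2)
                * solveSubsystemAux t fixed B b₁ b₂ (b₃ + 2))
          - (((b₁ : ℂ) + 1) * ((b₂ : ℂ) + 1) * t (e 0 + e 1)
                * solveSubsystemAux t fixed B (b₁ + 1) (b₂ + 1) b₃
              + ((b₁ : ℂ) + 1) * ((b₃ : ℂ) + 1) * t (e 0 + e 2)
                * solveSubsystemAux t fixed B (b₁ + 1) b₂ (b₃ + 1)
              + ((b₂ : ℂ) + 1) * ((b₃ : ℂ) + 1) * t (e 1 + e 2)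
                * solveSubsystemAux t fixed B b₁ (b₂ + 1) (b₃ + 1)))

/-- The solution `ξ` of the equations
`∑_k (β_k+2)(β_k+1) t_{2e_k} ξ_{β+2e_k} + ∑_{k<k'} (β_k+1)(β_{k'}+1) t_{e_k+e_{k'}} ξ_{β+e_k+e_{k'}} = B_β`
obtained by fixing `ξ_i = fixed i` when `i₁ ∈ {0, 1}` and then computing successively each
`ξ_{β+2e₁}` from the equation `β`, for increasing `β₁`. Equation `β` only involves `ξ_i` with
`|i| = |β| + 2`, so the layers `|i| = ℓ + 2` are solved independently of each other. -/
def solveSubsystem (t fixed B : MultiIndex → ℂ) (i : MultiIndex) : ℂ :=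
  solveSubsystemAux t fixed B (i 0) (i 1) (i 2)

/-! ## Amplitude-based generalized plane waves -/

/-- The right-hand side `B_β` of the amplitude-based subsystem: minus all the terms of the Taylor
coefficient of order `β` of
`∑_k c_{2e_k}(∂_k² Q + 2Λ_k ∂_k Q + Λ_k² Q) + ∑_{k<k'} c_{e_k+e_{k'}}(∂_k∂_{k'}Q + Λ_k ∂_{k'}Q + Λ_{k'} ∂_k Q + Λ_kΛ_{k'} Q)
  + ∑_k c_{e_k}(∂_k Q + Λ_k Q) + c_0 Q`
except those with a `μ_i` of length `|β| + 2`, which form the left-hand side of the subsystem. -/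
def amplitudeRHS (xC : Space) (c : MultiIndex → Space → ℂ) (Λ : Fin 3 → ℂ) (μ : MultiIndex → ℂ)
    (β : MultiIndex) : ℂ :=
  - (∑ γ ∈ Finset.Iio β,
      ((∑ k, taylor xC (c (2 • e k)) (β - γ) *
          (((γ k : ℂ) + 2) * ((γ k : ℂ) + 1) * μ (γ + 2 • e k)))
        + ∑ k, ∑ k' ∈ Finset.Ioi k, taylor xC (c (e k + e k')) (β - γ) *
          (((γ k : ℂ) + 1) * ((γ k' : ℂ) + 1) * μ (γ + e k + e k'))))
  - ∑ γ ∈ Finset.Iic β,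
      ((∑ k, taylor xC (c (2 • e k)) (β - γ) *
          (2 * Λ k * ((γ k : ℂ) + 1) * μ (γ + e k) + Λ k ^ 2 * μ γ))
        + (∑ k, ∑ k' ∈ Finset.Ioi k, taylor xC (c (e k + e k')) (β - γ) *
          (Λ k * ((γ k' : ℂ) + 1) * μ (γ + e k') + Λ k' * ((γ k : ℂ) + 1) * μ (γ + e k)
            + Λ k * Λ k' * μ γ))
        + (∑ k, taylor xC (c (e k)) (β - γ) * (((γ k : ℂ) + 1) * μ (γ + e k) + Λ k * μ γ))
        + taylor xC (c 0) (β - γ) * μ γ)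

/-- The amplitude coefficients `μ_i` after the layers `0, …, ℓ - 1` have been treated, with the
initialization `μ_0 = 1`, `μ_{e_k} = 0`, and `μ_i = 0` whenever `|i| ≥ 2`, `i₁ ∈ {0, 1}`. After `ℓ`
layers the `μ_i` with `|i| ≤ ℓ + 1` have their final values, and the longer ones are still `0`. -/
def amplitudeCoeffs (xC : Space) (c : MultiIndex → Space → ℂ) (Λ : Fin 3 → ℂ) :
    ℕ → MultiIndex → ℂ
  | 0 => fun i => if i = 0 then 1 else 0
  | ℓ + 1 => fun i =>
      if length i = ℓ + 2 then
        solveSubsystem (fun j => taylor xC (c j) 0) (fun _ => 0)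
          (amplitudeRHS xC c Λ (amplitudeCoeffs xC c Λ ℓ)) i
      else amplitudeCoeffs xC c Λ ℓ i

/-- The polynomial function `y ↦ ∑_{|i| ≤ d} a_i y^i`. -/
def polyFun (d : ℕ) (a : MultiIndex → ℂ) (y : Space) : ℂ :=
  ∑ i ∈ indicesUpTo d, a i * ∏ k, (y k : ℂ) ^ (i k)

/-- The amplitude-based generalized plane wave
`J(x) = Q(x - x_C) exp(Λ · (x - x_C))`, `Q = ∑_{|i| ≤ q+1} μ_i X^i`. -/
def amplitudeGPW (xC : Space) (c : MultiIndex → Space → ℂ) (q : ℕ) (Λ : Fin 3 → ℂ) : Space → ℂ :=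
  fun x => polyFun (q + 1) (amplitudeCoeffs xC c Λ q) (x - xC) *
    Complex.exp (∑ k, Λ k * ((x - xC) k : ℂ))

/-! ## Phase-based generalized plane waves -/

/-- The right-hand side `B_β` of the phase-based subsystem: minus all the terms of the Taylor
coefficient of order `β` of
`∑_k c_{2e_k}(∂_k² P + (∂_k P)²) + ∑_{k<k'} c_{e_k+e_{k'}}(∂_k∂_{k'}P + ∂_k P ∂_{k'}P)
  + ∑_k c_{e_k} ∂_k P + c_0`
except those with a `λ_i` of length `|β| + 2`, which form the left-hand side of the subsystem. -/
def phaseRHS (xC : Space) (c : MultiIndex → Space → ℂ) (lam : MultiIndex → ℂ)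
    (β : MultiIndex) : ℂ :=
  - (∑ γ ∈ Finset.Iio β,
      ((∑ k, taylor xC (c (2 • e k)) (β - γ) *
          (((γ k : ℂ) + 2) * ((γ k : ℂ) + 1) * lam (γ + 2 • e k)))
        + ∑ k, ∑ k' ∈ Finset.Ioi k, taylor xC (c (e k + e k')) (β - γ) *
          (((γ k : ℂ) + 1) * ((γ k' : ℂ) + 1) * lam (γ + e k + e k'))))
  - (∑ γ ∈ Finset.Iic β,
      ((∑ k, taylor xC (c (2 • e k)) (β - γ) *
          ∑ η ∈ Finset.Iic γ, (((γ - η) k : ℂ) + 1) * lam (γ - η + e k) *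
            (((η k : ℂ) + 1) * lam (η + e k)))
        + (∑ k, ∑ k' ∈ Finset.Ioi k, taylor xC (c (e k + e k')) (β - γ) *
          ∑ η ∈ Finset.Iic γ, (((γ - η) k' : ℂ) + 1) * lam (γ - η + e k') *
            (((η k : ℂ) + 1) * lam (η + e k)))
        + ∑ k, taylor xC (c (e k)) (β - γ) * (((γ k : ℂ) + 1) * lam (γ + e k))))
  - taylor xC (c 0) β

/-- The phase coefficients `λ_i` after the layers `0, …, ℓ - 1` have been treated, with the
initialization `λ_0 = 0`, `λ_{e_k} = Λ_k`, and `λ_i = 0` whenever `|i| ≥ 2`, `i₁ ∈ {0, 1}`. After `ℓ`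
layers the `λ_i` with `|i| ≤ ℓ + 1` have their final values, and the longer ones are still `0`. -/
def phaseCoeffs (xC : Space) (c : MultiIndex → Space → ℂ) (Λ : Fin 3 → ℂ) :
    ℕ → MultiIndex → ℂ
  | 0 => fun i => ∑ k, if i = e k then Λ k else 0
  | ℓ + 1 => fun i =>
      if length i = ℓ + 2 then
        solveSubsystem (fun j => taylor xC (c j) 0) (fun _ => 0)
          (phaseRHS xC c (phaseCoeffs xC c Λ ℓ)) i
      else phaseCoeffs xC c Λ ℓ i

/-- The phase-based generalized plane wave
`G(x) = exp(P(x - x_C))`, `P = ∑_{|i| ≤ q+1} λ_i X^i`. -/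
def phaseGPW (xC : Space) (c : MultiIndex → Space → ℂ) (q : ℕ) (Λ : Fin 3 → ℂ) : Space → ℂ :=
  fun x => Complex.exp (polyFun (q + 1) (phaseCoeffs xC c Λ q) (x - xC))

/-! ## Directions, linear parameters and the matrices of Taylor coefficients -/

/-- The pairs `(l, m)` with `0 ≤ l ≤ n` and `|m| ≤ l`. -/
abbrev DirectionIndex (n : ℕ) := Σ l : Fin (n + 1), Finset.Icc (-((l : ℕ) : ℤ)) ((l : ℕ) : ℤ)

/-- The unit vector `(sin θ cos φ, sin θ sin φ, cos θ)`. -/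
def direction (θ φ : ℝ) : Fin 3 → ℝ :=
  ![Real.sin θ * Real.cos φ, Real.sin θ * Real.sin φ, Real.cos θ]

/-- The vector `𝔰 P D^{-1/2} d` of `ℂ³`, where `R` is the diagonal of `D^{-1/2}` (any choice of the
complex square roots `R_k² = 1 / D_k`). -/
def linearParam (s : ℂ) (P : Matrix (Fin 3) (Fin 3) ℝ) (R : Fin 3 → ℂ) (d : Fin 3 → ℝ) :
    Fin 3 → ℂ :=
  s • ((P.map Complex.ofReal * Matrix.diagonal R).mulVec fun k => (d k : ℂ))

/-- The matrix of the Taylor coefficients `T_{b_l}[i]`, `|i| ≤ n`, of a family of functions `b_l`;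
the rows are indexed by the multi-indices themselves. -/
def taylorMatrix {ι : Type} (xC : Space) (n : ℕ) (b : ι → Space → ℂ) :
    Matrix (indicesUpTo n) ι ℂ :=
  Matrix.of fun i l => taylor xC (b l) i

end GPW

end

noncomputable section

namespace GPW

/-! ### Length of multi-indices -/

section Coefficients

/-! Everything is read as a function of the label of the parameter `Λ`, graded by degree as a
polynomial in `Λ`. The claim behind the theorem is `i! T_b[i] = Λ^i +` (degree less than `|i|`), for
both kinds of wave.

A crude count gives the coefficients `μ_i`, `λ_i` degree at most `|i|`; strict inequality is needed.
The obstruction is the quadratic term in the equation `β = 0`. It is the principal symbol at `Λ`,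
which equals `s²` for all the chosen parameters (`principalSymbol_linearParam`), so it has degree 0.
The strict bound then propagates through the layers (`amplitudeCoeffs_mem`, `phaseCoeffs_mem`) and
through differentiation (`weightLT_twistedMultiDeriv`).

By triangularity in `|i|`, a vector killed by the matrix is orthogonal to every polynomial in `Λ` of
degree at most `n` (`rank_taylorMatrix`). Directions are affine-linear data in `Λ`, so it suffices
to separate directions. For a point on circle `l`, take the `n - l` planes of the later circles, and
`l` vertical planes covering the other `2l` points of circle `l` in pairs (`exists_separating`). The
product has degree `n`, and these products form a triangular family
(`eq_zero_of_orthogonal_degreeLT`). -/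

theorem length_add (a b : MultiIndex) : length (a + b) = length a + length b := by
  simp [length, Finset.sum_add_distrib]

theorem length_e (k : Fin 3) : length (e k) = 1 := by
  simp [length, e]

theorem length_zero : length 0 = 0 := by
  simp [length]

theorem length_eq_zero {i : MultiIndex} : length i = 0 ↔ i = 0 := by
  simp [length, funext_iff]

theorem length_pos {i : MultiIndex} (h : i ≠ 0) : 0 < length i :=
  Nat.pos_of_ne_zero fun h0 => h (length_eq_zero.1 h0)

theorem length_mono {i j : MultiIndex} (h : i ≤ j) : length i ≤ length j :=
  Finset.sum_le_sum fun k _ => h k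

theorem length_lt {i j : MultiIndex} (h : i < j) : length i < length j :=
  Finset.sum_lt_sum (fun k _ => h.le k) (by
    obtain ⟨_, k, hk⟩ := Pi.lt_def.1 h
    exact ⟨k, Finset.mem_univ k, hk⟩)

theorem length_sub_add {i j : MultiIndex} (h : i ≤ j) : length (j - i) + length i = length j := by
  rw [← length_add, tsub_add_cancel_of_le h]

/-! ## Functions of a parameter that are polynomials of bounded degree -/

variable {ι : Type} {Λ : ι → Fin 3 → ℂ}

/-- The monomial `Λ^m` as a function of the label of the parameter `Λ`. -/
def paramMonomial (Λ : ι → Fin 3 → ℂ) (m : MultiIndex) : ι → ℂ :=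
  fun x => ∏ k, Λ x k ^ m k

/-- The functions of the label `x` which are polynomials of degree less than `d` in `Λ x`. -/
def degreeLT (Λ : ι → Fin 3 → ℂ) (d : ℕ) : Submodule ℂ (ι → ℂ) :=
  Submodule.span ℂ {f | ∃ m : MultiIndex, length m < d ∧ f = paramMonomial Λ m}

theorem paramMonomial_mem {m : MultiIndex} {d : ℕ} (h : length m < d) :
    paramMonomial Λ m ∈ degreeLT Λ d :=
  Submodule.subset_span ⟨m, h, rfl⟩

theorem paramMonomial_mul (m m' : MultiIndex) :
    paramMonomial Λ m * paramMonomial Λ m' = paramMonomial Λ (m + m') := by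
  ext x
  simp [paramMonomial, pow_add, Finset.prod_mul_distrib]

theorem paramMonomial_zero : paramMonomial Λ 0 = 1 := by
  ext x
  simp [paramMonomial]

theorem paramMonomial_e (k : Fin 3) : paramMonomial Λ (e k) = fun x => Λ x k := by
  ext x
  simp only [paramMonomial, e]
  rw [Finset.prod_eq_single k] <;> simp +contextual

theorem degreeLT_mono {d d' : ℕ} (h : d ≤ d') : degreeLT Λ d ≤ degreeLT Λ d' :=
  Submodule.span_mono fun _ ⟨m, hm, hf⟩ => ⟨m, hm.trans_le h, hf⟩

/-- The asymmetry is deliberate: degree at most `a` times degree less than `b` is less than `a + b`,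
so one strict factor makes the product strict. -/
theorem mul_mem_degreeLT {a b : ℕ} {f g : ι → ℂ} (hf : f ∈ degreeLT Λ (a + 1))
    (hg : g ∈ degreeLT Λ b) : f * g ∈ degreeLT Λ (a + b) := by
  have h := Submodule.mul_mem_mul hf hg
  rw [degreeLT, degreeLT, Submodule.span_mul_span] at h
  refine Submodule.span_le.2 ?_ h
  rintro _ ⟨_, ⟨m, hm, rfl⟩, _, ⟨m', hm', rfl⟩, rfl⟩
  change paramMonomial Λ m * paramMonomial Λ m' ∈ _
  rw [paramMonomial_mul]
  exact paramMonomial_mem (by rw [length_add]; omega)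

theorem const_mem_degreeLT (z : ℂ) {d : ℕ} (hd : 0 < d) : (fun _ => z) ∈ degreeLT Λ d := by
  have h := (degreeLT Λ d).smul_mem z (paramMonomial_mem (Λ := Λ) (m := 0) (by rwa [length_zero]))
  rw [paramMonomial_zero] at h
  convert h using 1
  ext x
  simp

theorem param_mem_degreeLT (k : Fin 3) {d : ℕ} (hd : 1 < d) : (fun x => Λ x k) ∈ degreeLT Λ d := by
  rw [← paramMonomial_e]
  exact paramMonomial_mem (by rwa [length_e])

theorem sum_mem_degreeLT {κ : Type*} {s : Finset κ} {f : κ → ι → ℂ} {d : ℕ}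
    (h : ∀ a ∈ s, f a ∈ degreeLT Λ d) : (fun x => ∑ a ∈ s, f a x) ∈ degreeLT Λ d := by
  have := Submodule.sum_mem _ h
  convert this using 1
  ext x
  simp

theorem const_mul_mem_degreeLT (z : ℂ) {f : ι → ℂ} {d : ℕ} (h : f ∈ degreeLT Λ d) :
    (fun x => z * f x) ∈ degreeLT Λ d :=
  (degreeLT Λ d).smul_mem z h

theorem mul_mem_degreeLT' {a b d : ℕ} {f g : ι → ℂ} (hf : f ∈ degreeLT Λ (a + 1))
    (hg : g ∈ degreeLT Λ b) (h : a + b ≤ d) : (fun x => f x * g x) ∈ degreeLT Λ d :=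
  degreeLT_mono h (mul_mem_degreeLT hf hg)

/-! ## Degrees of the coefficients of the generalized plane waves -/

/-- The matrix `t` does not depend on the parameter, so substitution only forms constant linear
combinations of the right-hand sides of one layer. -/
theorem solveSubsystemAux_mem (t : MultiIndex → ℂ) (B : ι → MultiIndex → ℂ) (d N : ℕ)
    (hB : ∀ β, length β + 2 = N → (fun x => B x β) ∈ degreeLT Λ d) (b₁ : ℕ) :
    ∀ b₂ b₃, b₁ + b₂ + b₃ = N →
      (fun x => solveSubsystemAux t (fun _ => 0) (B x) b₁ b₂ b₃) ∈ degreeLT Λ d := by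
  induction b₁ using Nat.strong_induction_on with
  | _ b₁ ih =>
    intro b₂ b₃ h
    match b₁, ih, h with
    | 0, _, _ => simp only [solveSubsystemAux]; exact zero_mem _
    | 1, _, _ => simp only [solveSubsystemAux]; exact zero_mem _
    | b + 2, ih, h =>
      simp only [solveSubsystemAux]
      refine const_mul_mem_degreeLT _ (sub_mem (sub_mem (hB _ ?_) (add_mem ?_ ?_))
        (add_mem (add_mem ?_ ?_) ?_))
      · simp [length, Fin.sum_univ_three]; omega
      all_goals exact const_mul_mem_degreeLT _ (ih _ (by omega) _ _ (by omega))

theorem solveSubsystem_mem (t : MultiIndex → ℂ) (B : ι → MultiIndex → ℂ) (d : ℕ) (i : MultiIndex)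
    (hB : ∀ β, length β + 2 = length i → (fun x => B x β) ∈ degreeLT Λ d) :
    (fun x => solveSubsystem t (fun _ => 0) (B x) i) ∈ degreeLT Λ d :=
  solveSubsystemAux_mem t B d (length i) hB _ _ _ (by simp [length, Fin.sum_univ_three])

/-- The quadratic form `∑_k c_{2e_k}(x_C) Λ_k² + ∑_{k<k'} c_{e_k+e_{k'}}(x_C) Λ_k Λ_{k'}`, the value
at `Λ` of the principal symbol. -/
def principalSymbol (xC : Space) (c : MultiIndex → Space → ℂ) (Λ : Fin 3 → ℂ) : ℂ :=
  (∑ k, taylor xC (c (2 • e k)) 0 * Λ k ^ 2) +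
    ∑ k, ∑ k' ∈ Finset.Ioi k, taylor xC (c (e k + e k')) 0 * (Λ k * Λ k')

variable {xC : Space} {c : MultiIndex → Space → ℂ} {z : ℂ}

/-- Only `μ_0 = 1` fails the strict bound, so the dangerous terms are `Λ_k Λ_{k'} μ_0`. For `β ≠ 0`
their degree 2 is below `|β| + 2`; for `β = 0` they add up to the constant principal symbol. -/
theorem amplitudeRHS_mem (hz : ∀ x, principalSymbol xC c (Λ x) = z) (μ : ι → MultiIndex → ℂ)
    (h0 : ∀ x, μ x 0 = 1) (he : ∀ x k, μ x (e k) = 0)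
    (hμ : ∀ i, i ≠ 0 → (fun x => μ x i) ∈ degreeLT Λ (length i)) (β : MultiIndex) :
    (fun x => amplitudeRHS xC c (Λ x) (μ x) β) ∈ degreeLT Λ (length β + 2) := by
  have hadd : ∀ (γ : MultiIndex) k, (fun x => μ x (γ + e k)) ∈ degreeLT Λ (length γ + 1) := by
    intro γ k
    have := hμ (γ + e k) (fun h => by
      have := congrArg length h; rw [length_add, length_e, length_zero] at this; omega)
    rwa [length_add, length_e] at this
  have hadd2 : ∀ (γ : MultiIndex) k k',
      (fun x => μ x (γ + e k + e k')) ∈ degreeLT Λ (length γ + 2) := by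
    intro γ k k'
    have := hadd (γ + e k) k'
    rwa [length_add, length_e] at this
  have hμ1 : ∀ i, (fun x => μ x i) ∈ degreeLT Λ (length i + 1) := by
    intro i
    rcases eq_or_ne i 0 with rfl | hi
    · simp only [h0]
      exact const_mem_degreeLT _ (Nat.succ_pos _)
    · exact degreeLT_mono (Nat.le_succ _) (hμ i hi)
  have hΛ : ∀ k, (fun x => Λ x k) ∈ degreeLT Λ (1 + 1) := fun k => param_mem_degreeLT k (by omega)
  have hΛμ : ∀ k (γ : MultiIndex) k' (r : ℂ), γ ≤ β →
      (fun x => Λ x k * (r * μ x (γ + e k'))) ∈ degreeLT Λ (length β + 2) := by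
    intro k γ k' r hγ
    have := length_mono hγ
    exact mul_mem_degreeLT' (hΛ k) (const_mul_mem_degreeLT r (hadd γ k')) (by omega)
  by_cases hβ : β = 0
  · subst hβ
    have hI : Finset.Iio (0 : MultiIndex) = ∅ := Finset.Iio_eq_empty.2 (fun _ _ => bot_le)
    have hI' : Finset.Iic (0 : MultiIndex) = {0} := Finset.Iic_bot
    have : (fun x => amplitudeRHS xC c (Λ x) (μ x) 0) =
        fun x => - z - ((∑ k, taylor xC (c (e k)) 0 * Λ x k) + taylor xC (c 0) 0) := by
      ext x
      rw [← hz x]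
      simp only [amplitudeRHS, principalSymbol, hI, hI', Finset.sum_empty, Finset.sum_singleton,
        zero_add, h0, he, tsub_self, mul_zero, mul_one]
      ring
    rw [this]
    exact sub_mem (const_mem_degreeLT _ (by omega)) (add_mem (sum_mem_degreeLT fun k _ =>
      const_mul_mem_degreeLT _ (param_mem_degreeLT k (by omega))) (const_mem_degreeLT _ (by omega)))
  · have hβ1 := length_pos hβ
    have hΛΛ : ∀ k k' (γ : MultiIndex), γ ≤ β →
        (fun x => Λ x k * (Λ x k' * μ x γ)) ∈ degreeLT Λ (length β + 2) := by
      intro k k' γ hγ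
      have := length_mono hγ
      rcases eq_or_ne γ 0 with rfl | hi
      · exact mul_mem_degreeLT' (hΛ k) (mul_mem_degreeLT' (hΛ k') (hμ1 0) le_rfl)
          (by rw [length_zero]; omega)
      · exact mul_mem_degreeLT' (hΛ k) (mul_mem_degreeLT' (hΛ k') (hμ γ hi) le_rfl) (by omega)
    refine sub_mem (neg_mem (sum_mem_degreeLT fun γ hγ => ?_)) (sum_mem_degreeLT fun γ hγ => ?_)
    · have hγ' := length_lt (Finset.mem_Iio.1 hγ)
      refine add_mem (sum_mem_degreeLT fun k _ => ?_) (sum_mem_degreeLT fun k _ =>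
        sum_mem_degreeLT fun k' _ => ?_)
      · refine const_mul_mem_degreeLT _ (const_mul_mem_degreeLT _ ?_)
        simp only [two_nsmul, ← add_assoc]
        exact degreeLT_mono (by omega) (hadd2 γ k k)
      · exact const_mul_mem_degreeLT _ (const_mul_mem_degreeLT _
          (degreeLT_mono (by omega) (hadd2 γ k k')))
    · have hγ := Finset.mem_Iic.1 hγ
      have hγ' := length_mono hγ
      refine add_mem (add_mem (add_mem (sum_mem_degreeLT fun k _ => const_mul_mem_degreeLT _ ?_)
        (sum_mem_degreeLT fun k _ => sum_mem_degreeLT fun k' _ => const_mul_mem_degreeLT _ ?_))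
        (sum_mem_degreeLT fun k _ => const_mul_mem_degreeLT _ ?_)) (const_mul_mem_degreeLT _ ?_)
      · convert add_mem (hΛμ k γ k (2 * ((γ k : ℂ) + 1)) hγ) (hΛΛ k k γ hγ) using 1
        ext x; simp only [Pi.add_apply]; ring
      · convert add_mem (add_mem (hΛμ k γ k' ((γ k' : ℂ) + 1) hγ)
          (hΛμ k' γ k ((γ k : ℂ) + 1) hγ)) (hΛΛ k k' γ hγ) using 1
        ext x; simp only [Pi.add_apply]; ring
      · exact add_mem (const_mul_mem_degreeLT _ (degreeLT_mono (by omega) (hadd γ k)))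
          (mul_mem_degreeLT' (hΛ k) (hμ1 γ) (by omega))
      · exact degreeLT_mono (by omega) (hμ1 γ)

theorem amplitudeCoeffs_zero (Λ : Fin 3 → ℂ) (ℓ : ℕ) : amplitudeCoeffs xC c Λ ℓ 0 = 1 := by
  induction ℓ with
  | zero => simp [amplitudeCoeffs]
  | succ ℓ ih => simp [amplitudeCoeffs, ih, length_zero]

theorem e_ne_zero (k : Fin 3) : e k ≠ 0 := by
  intro h
  have := congrArg length h
  simp [length_e, length_zero] at this

theorem amplitudeCoeffs_e (Λ : Fin 3 → ℂ) (ℓ : ℕ) (k : Fin 3) :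
    amplitudeCoeffs xC c Λ ℓ (e k) = 0 := by
  induction ℓ with
  | zero => simp [amplitudeCoeffs, e_ne_zero]
  | succ ℓ ih => simp [amplitudeCoeffs, ih, length_e]

theorem amplitudeCoeffs_mem (hz : ∀ x, principalSymbol xC c (Λ x) = z) (ℓ : ℕ) :
    ∀ i, i ≠ 0 → (fun x => amplitudeCoeffs xC c (Λ x) ℓ i) ∈ degreeLT Λ (length i) := by
  induction ℓ with
  | zero =>
    intro i hi
    simp only [amplitudeCoeffs, hi, if_false]
    exact zero_mem _
  | succ ℓ ih =>
    intro i hi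
    simp only [amplitudeCoeffs]
    split_ifs with h
    · refine solveSubsystem_mem _ _ _ i fun β hβ => ?_
      rw [← hβ]
      exact amplitudeRHS_mem hz _ (fun x => amplitudeCoeffs_zero _ _)
        (fun x k => amplitudeCoeffs_e _ _ _) ih β
    · exact ih i hi

/-- Here the coefficients violating the strict bound are `λ_{e_k} = Λ_k`. A product of two of them
is harmless for `β ≠ 0`, and for `β = 0` such products sum to the principal symbol. -/
theorem phaseRHS_mem (hz : ∀ x, principalSymbol xC c (Λ x) = z) (lam : ι → MultiIndex → ℂ)
    (he : ∀ x k, lam x (e k) = Λ x k)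
    (hlam : ∀ i, 2 ≤ length i → (fun x => lam x i) ∈ degreeLT Λ (length i)) (β : MultiIndex) :
    (fun x => phaseRHS xC c (lam x) β) ∈ degreeLT Λ (length β + 2) := by
  have hadd1 : ∀ (γ : MultiIndex) k, γ ≠ 0 →
      (fun x => lam x (γ + e k)) ∈ degreeLT Λ (length γ + 1) := by
    intro γ k hγ
    have hγ := length_pos hγ
    have := hlam (γ + e k) (by rw [length_add, length_e]; omega)
    rwa [length_add, length_e] at this
  have hadd : ∀ (γ : MultiIndex) k, (fun x => lam x (γ + e k)) ∈ degreeLT Λ (length γ + 2) := by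
    intro γ k
    rcases eq_or_ne γ 0 with rfl | hγ
    · simp only [zero_add, he]
      exact param_mem_degreeLT k (by omega)
    · exact degreeLT_mono (by omega) (hadd1 γ k hγ)
  have hadd2 : ∀ (γ : MultiIndex) k k',
      (fun x => lam x (γ + e k + e k')) ∈ degreeLT Λ (length γ + 2) := by
    intro γ k k'
    have := hadd1 (γ + e k) k' (fun h => by
      have := congrArg length h; rw [length_add, length_e, length_zero] at this; omega)
    rwa [length_add, length_e] at this
  by_cases hβ : β = 0
  · subst hβ
    have hI : Finset.Iio (0 : MultiIndex) = ∅ := Finset.Iio_eq_empty.2 (fun _ _ => bot_le)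
    have hI' : Finset.Iic (0 : MultiIndex) = {0} := Finset.Iic_bot
    have : (fun x => phaseRHS xC c (lam x) 0) =
        fun x => - z - ((∑ k, taylor xC (c (e k)) 0 * Λ x k) + taylor xC (c 0) 0) := by
      ext x
      have hcomm : ∀ k, ∑ k' ∈ Finset.Ioi k, taylor xC (c (e k + e k')) 0 * (Λ x k * Λ x k') =
          ∑ k' ∈ Finset.Ioi k, taylor xC (c (e k + e k')) 0 * (Λ x k' * Λ x k) :=
        fun k => Finset.sum_congr rfl fun k' _ => by rw [mul_comm (Λ x k)]
      rw [← hz x]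
      simp only [hcomm, phaseRHS, principalSymbol, hI, hI', Finset.sum_empty, Finset.sum_singleton,
        zero_add, he, tsub_self, Pi.zero_apply, Nat.cast_zero, one_mul, pow_two]
      ring
    rw [this]
    exact sub_mem (const_mem_degreeLT _ (by omega)) (add_mem (sum_mem_degreeLT fun k _ =>
      const_mul_mem_degreeLT _ (param_mem_degreeLT k (by omega))) (const_mem_degreeLT _ (by omega)))
  · have hβ1 := length_pos hβ
    have hquad : ∀ γ, γ ≤ β → ∀ η ∈ Finset.Iic γ, ∀ k k', (fun x =>
        (((γ - η) k' : ℂ) + 1) * lam x (γ - η + e k') * (((η k : ℂ) + 1) * lam x (η + e k)))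
          ∈ degreeLT Λ (length β + 2) := by
      intro γ hγ η hη k k'
      have hγ := length_mono hγ
      have hη := length_sub_add (Finset.mem_Iic.1 hη)
      -- If `η` or `γ - η` is nonzero, its factor satisfies the strict bound. Otherwise `γ = 0` and
      -- the product has degree 2, which is less than `|β| + 2`.
      rcases eq_or_ne η 0 with rfl | h
      · rw [length_zero] at hη
        by_cases hγ0 : γ - 0 = 0
        · rw [hγ0] at hη ⊢
          rw [length_zero] at hη
          exact mul_mem_degreeLT' (a := 1) (const_mul_mem_degreeLT _ (hadd 0 k'))
            (const_mul_mem_degreeLT _ (hadd 0 k)) (by rw [length_zero]; omega)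
        · exact mul_mem_degreeLT' (const_mul_mem_degreeLT _ (hadd1 _ k' hγ0))
            (const_mul_mem_degreeLT _ (hadd 0 k)) (by rw [length_zero]; omega)
      · exact mul_mem_degreeLT' (a := length (γ - η) + 1) (const_mul_mem_degreeLT _ (hadd _ k'))
            (const_mul_mem_degreeLT _ (hadd1 _ k h)) (by omega)
    refine sub_mem (sub_mem (neg_mem (sum_mem_degreeLT fun γ hγ => ?_))
      (sum_mem_degreeLT fun γ hγ => ?_)) (const_mem_degreeLT _ (by omega))
    · have hγ' := length_lt (Finset.mem_Iio.1 hγ)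
      refine add_mem (sum_mem_degreeLT fun k _ => ?_) (sum_mem_degreeLT fun k _ =>
        sum_mem_degreeLT fun k' _ => ?_)
      · refine const_mul_mem_degreeLT _ (const_mul_mem_degreeLT _ ?_)
        simp only [two_nsmul, ← add_assoc]
        exact degreeLT_mono (by omega) (hadd2 γ k k)
      · exact const_mul_mem_degreeLT _ (const_mul_mem_degreeLT _
          (degreeLT_mono (by omega) (hadd2 γ k k')))
    · have hγ := Finset.mem_Iic.1 hγ
      have hγ' := length_mono hγ
      refine add_mem (add_mem (sum_mem_degreeLT fun k _ => const_mul_mem_degreeLT _ ?_)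
        (sum_mem_degreeLT fun k _ => sum_mem_degreeLT fun k' _ => const_mul_mem_degreeLT _ ?_))
        (sum_mem_degreeLT fun k _ => const_mul_mem_degreeLT _ ?_)
      · exact sum_mem_degreeLT fun η hη => hquad γ hγ η hη k k
      · exact sum_mem_degreeLT fun η hη => hquad γ hγ η hη k k'
      · exact const_mul_mem_degreeLT _ (degreeLT_mono (by omega) (hadd γ k))

theorem phaseCoeffs_zero (Λ : Fin 3 → ℂ) (ℓ : ℕ) : phaseCoeffs xC c Λ ℓ 0 = 0 := by
  induction ℓ with
  | zero => simp [phaseCoeffs, (e_ne_zero _).symm]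
  | succ ℓ ih => simp [phaseCoeffs, ih, length_zero]

theorem e_injective : Function.Injective e := by
  intro k k' h
  by_contra hk
  have := congrFun h k
  simp [e, hk] at this

theorem phaseCoeffs_e (Λ : Fin 3 → ℂ) (ℓ : ℕ) (k : Fin 3) :
    phaseCoeffs xC c Λ ℓ (e k) = Λ k := by
  induction ℓ with
  | zero => simp [phaseCoeffs, e_injective.eq_iff]
  | succ ℓ ih => simp [phaseCoeffs, ih, length_e]

theorem phaseCoeffs_mem (hz : ∀ x, principalSymbol xC c (Λ x) = z) (ℓ : ℕ) :
    ∀ i, 2 ≤ length i → (fun x => phaseCoeffs xC c (Λ x) ℓ i) ∈ degreeLT Λ (length i) := by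
  induction ℓ with
  | zero =>
    intro i hi
    have : ∀ k, i ≠ e k := by
      rintro k rfl
      rw [length_e] at hi
      omega
    simp only [phaseCoeffs, this, if_false, Finset.sum_const_zero]
    exact zero_mem _
  | succ ℓ ih =>
    intro i hi
    simp only [phaseCoeffs]
    split_ifs with h
    · refine solveSubsystem_mem _ _ _ i fun β hβ => ?_
      rw [← hβ]
      exact phaseRHS_mem hz _ (fun x k => phaseCoeffs_e _ _ _) ih β
    · exact ih i hi

end Coefficients

section Derivatives

open MvPolynomial

/-! ## Derivatives of products of a polynomial and the exponential of a polynomial -/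

/-- The polynomial `q` such that `∂_k (p exp P) = q exp P`. -/
def twistedDeriv {A : Type*} [CommRing A] (P : MvPolynomial (Fin 3) A) (k : Fin 3)
    (p : MvPolynomial (Fin 3) A) : MvPolynomial (Fin 3) A :=
  pderiv k p + p * pderiv k P

/-- The polynomial `q` such that `∂^i (p exp P) = q exp P`. -/
def twistedMultiDeriv {A : Type*} [CommRing A] (P : MvPolynomial (Fin 3) A) (i : MultiIndex)
    (p : MvPolynomial (Fin 3) A) : MvPolynomial (Fin 3) A :=
  (twistedDeriv P 0)^[i 0] ((twistedDeriv P 1)^[i 1] ((twistedDeriv P 2)^[i 2] p))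

theorem map_twistedDeriv {A B : Type*} [CommRing A] [CommRing B] (f : A →+* B)
    (P : MvPolynomial (Fin 3) A) (k : Fin 3) (p : MvPolynomial (Fin 3) A) :
    map f (twistedDeriv P k p) = twistedDeriv (map f P) k (map f p) := by
  simp [twistedDeriv, pderiv_map]

/-- Lets the derivatives be computed once over the ring `ι → ℂ` of functions of the parameter, then
specialized to each parameter by evaluation. -/
theorem map_twistedMultiDeriv {A B : Type*} [CommRing A] [CommRing B] (f : A →+* B)
    (P : MvPolynomial (Fin 3) A) (i : MultiIndex) (p : MvPolynomial (Fin 3) A) :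
    map f (twistedMultiDeriv P i p) = twistedMultiDeriv (map f P) i (map f p) := by
  have h : ∀ k, Function.Semiconj (map f) (twistedDeriv P k) (twistedDeriv (map f P) k) :=
    fun k p => map_twistedDeriv f P k p
  simp only [twistedMultiDeriv, ((h _).iterate_right _).eq]

/-- The value of a complex polynomial at a point of the space. -/
def evalAt (xC : Space) (p : MvPolynomial (Fin 3) ℂ) (x : Space) : ℂ :=
  eval (fun k => ((x - xC) k : ℂ)) p

/-- The function `p(x - x_C) exp P(x - x_C)`. -/
def polyExp (xC : Space) (P p : MvPolynomial (Fin 3) ℂ) (x : Space) : ℂ :=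
  evalAt xC p x * Complex.exp (evalAt xC P x)

/-- The `k`-th coordinate as a complex-valued real-linear map. -/
def coordCLM (k : Fin 3) : Space →L[ℝ] ℂ :=
  Complex.ofRealCLM.comp (EuclideanSpace.proj k)

theorem exists_hasFDerivAt_evalAt (xC : Space) (p : MvPolynomial (Fin 3) ℂ) (x : Space) :
    ∃ L : Space →L[ℝ] ℂ, HasFDerivAt (evalAt xC p) L x ∧
      ∀ k, L (EuclideanSpace.single k 1) = evalAt xC (pderiv k p) x := by
  induction p using MvPolynomial.induction_on with
  | C a =>
    have hf : evalAt xC (C a) = fun _ => a := by ext y; simp [evalAt]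
    rw [hf]
    exact ⟨0, hasFDerivAt_const a x, fun k => by simp [evalAt]⟩
  | add p q hp hq =>
    obtain ⟨L, hL, hLk⟩ := hp
    obtain ⟨L', hL', hLk'⟩ := hq
    have hf : evalAt xC (p + q) = evalAt xC p + evalAt xC q := by ext y; simp [evalAt]
    rw [hf]
    exact ⟨L + L', hL.add hL', fun k => by rw [add_apply, hLk, hLk']; simp [evalAt]⟩
  | mul_X p j hp =>
    obtain ⟨L, hL, hLk⟩ := hp
    have hX : HasFDerivAt (evalAt xC (X j)) (coordCLM j) x := by
      have hf : evalAt xC (X j) = fun y => coordCLM j y - (xC j : ℂ) := by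
        ext y; simp [evalAt, coordCLM]
      rw [hf]
      exact (coordCLM j).hasFDerivAt.sub_const _
    have hf : evalAt xC (p * X j) = evalAt xC p * evalAt xC (X j) := by ext y; simp [evalAt]
    rw [hf]
    refine ⟨_, hL.mul hX, fun k => ?_⟩
    rw [add_apply, smul_apply, smul_apply, hLk]
    simp only [evalAt, Derivation.leibniz, smul_eq_mul, map_add, map_mul, pderiv_X]
    rcases eq_or_ne k j with rfl | h
    · simp [coordCLM]
    · simp [coordCLM, h.symm]

theorem partialDeriv_polyExp (xC : Space) (P : MvPolynomial (Fin 3) ℂ) (k : Fin 3)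
    (p : MvPolynomial (Fin 3) ℂ) :
    partialDeriv k (polyExp xC P p) = polyExp xC P (twistedDeriv P k p) := by
  ext x
  obtain ⟨L, hL, hLk⟩ := exists_hasFDerivAt_evalAt xC p x
  obtain ⟨L', hL', hLk'⟩ := exists_hasFDerivAt_evalAt xC P x
  have h := hL.mul hL'.cexp
  change fderiv ℝ (evalAt xC p * fun x => Complex.exp (evalAt xC P x)) x _ = _
  rw [h.fderiv]
  simp only [add_apply, smul_apply, hLk, hLk', smul_eq_mul]
  simp only [polyExp, twistedDeriv, evalAt, map_add, map_mul]
  ring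

theorem multiDeriv_polyExp (xC : Space) (P : MvPolynomial (Fin 3) ℂ) (i : MultiIndex)
    (p : MvPolynomial (Fin 3) ℂ) :
    multiDeriv i (polyExp xC P p) = polyExp xC P (twistedMultiDeriv P i p) := by
  have h : ∀ k, Function.Semiconj (polyExp xC P) (twistedDeriv P k) (partialDeriv k) :=
    fun k p => (partialDeriv_polyExp xC P k p).symm
  simp only [multiDeriv, twistedMultiDeriv, ((h _).iterate_right _).eq]

theorem evalAt_center (xC : Space) (p : MvPolynomial (Fin 3) ℂ) :
    evalAt xC p xC = coeff 0 p := by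
  rw [evalAt, ← constantCoeff_eq, ← eval_zero']
  simp

theorem taylor_polyExp (xC : Space) (P : MvPolynomial (Fin 3) ℂ) (hP : coeff 0 P = 0)
    (p : MvPolynomial (Fin 3) ℂ) (i : MultiIndex) :
    taylor xC (polyExp xC P p) i = coeff 0 (twistedMultiDeriv P i p) / (multiFactorial i : ℂ) := by
  rw [taylor, multiDeriv_polyExp, polyExp, evalAt_center, evalAt_center, hP, Complex.exp_zero,
    mul_one]

/-! ## Families of polynomials with coefficients of bounded degree in a parameter -/

variable {ι : Type} {Λ : ι → Fin 3 → ℂ}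

/-- The coefficient of `X^m` has degree less than `|m| + w` in the parameter. -/
def WeightLT (Λ : ι → Fin 3 → ℂ) (w : ℕ) (p : MvPolynomial (Fin 3) (ι → ℂ)) : Prop :=
  ∀ m : Fin 3 →₀ ℕ, coeff m p ∈ degreeLT Λ (length m + w)

theorem length_coe_add (m m' : Fin 3 →₀ ℕ) : length ⇑(m + m') = length m + length m' := by
  rw [Finsupp.coe_add, length_add]

theorem length_coe_zero : length ⇑(0 : Fin 3 →₀ ℕ) = 0 := by
  rw [Finsupp.coe_zero, length_zero]

theorem WeightLT.mono {w w' : ℕ} {p : MvPolynomial (Fin 3) (ι → ℂ)} (h : WeightLT Λ w p)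
    (hw : w ≤ w') : WeightLT Λ w' p :=
  fun m => degreeLT_mono (by omega) (h m)

theorem WeightLT.add {w : ℕ} {p q : MvPolynomial (Fin 3) (ι → ℂ)} (hp : WeightLT Λ w p)
    (hq : WeightLT Λ w q) : WeightLT Λ w (p + q) := by
  intro m
  rw [coeff_add]
  exact add_mem (hp m) (hq m)

theorem WeightLT.mul {w w' : ℕ} {p q : MvPolynomial (Fin 3) (ι → ℂ)} (hp : WeightLT Λ (w + 1) p)
    (hq : WeightLT Λ w' q) : WeightLT Λ (w + w') (p * q) := by
  intro m
  rw [coeff_mul]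
  refine Submodule.sum_mem _ fun a ha => ?_
  rw [← Finset.HasAntidiagonal.mem_antidiagonal.1 ha, length_coe_add]
  have h := mul_mem_degreeLT (a := length a.1 + w) (hp a.1) (hq a.2)
  exact degreeLT_mono (by omega) h

theorem weightLT_C {w : ℕ} {f : ι → ℂ} (hf : f ∈ degreeLT Λ w) : WeightLT Λ w (C f) := by
  intro m
  rw [coeff_C]
  split_ifs with h
  · exact degreeLT_mono (by omega) hf
  · exact zero_mem _

theorem WeightLT.pderiv {w : ℕ} {p : MvPolynomial (Fin 3) (ι → ℂ)} (hp : WeightLT Λ w p)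
    (k : Fin 3) : WeightLT Λ (w + 1) (MvPolynomial.pderiv k p) := by
  intro m
  rw [coeff_pderiv]
  have h := hp (m + Finsupp.single k 1)
  rw [length_coe_add, Finsupp.single_eq_pi_single] at h
  change _ ∈ degreeLT Λ (length m + length (e k) + w) at h
  rw [length_e] at h
  rw [add_assoc, add_comm 1] at h
  convert (degreeLT Λ _).smul_mem (m k + 1 : ℂ) h using 1
  ext x
  simp [mul_comm]

/-- With `p = f + r` and `∂_k P = Λ_k + ρ`, the remainder is `∂_k r + f ρ + Λ_k r + r ρ`, and each
term has weight less than the main term `f Λ_k` allows. -/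
theorem weightLT_twistedDeriv {P : MvPolynomial (Fin 3) (ι → ℂ)} {k : Fin 3}
    (hP : WeightLT Λ 1 (pderiv k P - C fun x => Λ x k)) {w : ℕ}
    {p : MvPolynomial (Fin 3) (ι → ℂ)} {f : ι → ℂ} (hf : f ∈ degreeLT Λ (w + 1))
    (hp : WeightLT Λ w (p - C f)) :
    WeightLT Λ (w + 1) (twistedDeriv P k p - C (f * fun x => Λ x k)) := by
  have hΛ : WeightLT Λ (1 + 1) (C fun x => Λ x k) := weightLT_C (param_mem_degreeLT k (by omega))
  have h := (((hp.pderiv k).add ((weightLT_C hf).mul hP)).add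
    ((hΛ.mul hp).mono (add_comm 1 w).le)).add ((WeightLT.mul (w := 0) hP hp).mono (by omega))
  convert h using 1
  simp only [twistedDeriv, map_sub, pderiv_C, C_mul]
  ring

theorem weightLT_twistedDeriv_iterate {P : MvPolynomial (Fin 3) (ι → ℂ)} {k : Fin 3}
    (hP : WeightLT Λ 1 (pderiv k P - C fun x => Λ x k))
    {p : MvPolynomial (Fin 3) (ι → ℂ)} {m : MultiIndex}
    (hp : WeightLT Λ (length m) (p - C (paramMonomial Λ m))) (r : ℕ) :
    WeightLT Λ (length (m + r • e k))
      ((twistedDeriv P k)^[r] p - C (paramMonomial Λ (m + r • e k))) := by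
  induction r with
  | zero => simpa using hp
  | succ r ih =>
    rw [Function.iterate_succ_apply', succ_nsmul, ← add_assoc, ← paramMonomial_mul,
      paramMonomial_e, length_add, length_e]
    exact weightLT_twistedDeriv hP (paramMonomial_mem (Nat.lt_succ_self _)) ih

theorem weightLT_twistedMultiDeriv {P : MvPolynomial (Fin 3) (ι → ℂ)}
    (hP : ∀ k, WeightLT Λ 1 (pderiv k P - C fun x => Λ x k))
    {p : MvPolynomial (Fin 3) (ι → ℂ)} (hp : WeightLT Λ 0 (p - 1)) (i : MultiIndex) :
    WeightLT Λ (length i) (twistedMultiDeriv P i p - C (paramMonomial Λ i)) := by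
  have h0 : WeightLT Λ (length 0) (p - C (paramMonomial Λ 0)) := by
    rwa [length_zero, paramMonomial_zero, C_1]
  have h := weightLT_twistedDeriv_iterate (hP 0) (weightLT_twistedDeriv_iterate (hP 1)
    (weightLT_twistedDeriv_iterate (hP 2) h0 (i 2)) (i 1)) (i 0)
  have hi : 0 + i 2 • e 2 + i 1 • e 1 + i 0 • e 0 = i := by
    ext k
    fin_cases k <;> simp [e]
  rwa [hi] at h

/-- At the centre the exponential is 1, so only the constant coefficient of the twisted derivative
survives, where the weight bound is a plain degree bound. -/
theorem taylor_polyExp_mem {P p : MvPolynomial (Fin 3) (ι → ℂ)} (xC : Space)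
    (hP0 : coeff 0 P = 0) (hP : ∀ k, WeightLT Λ 1 (pderiv k P - C fun x => Λ x k))
    (hp : WeightLT Λ 0 (p - 1)) (i : MultiIndex) :
    (fun x => multiFactorial i * taylor xC
      (polyExp xC (map (Pi.evalRingHom _ x) P) (map (Pi.evalRingHom _ x) p)) i)
      - paramMonomial Λ i ∈ degreeLT Λ (length i) := by
  have h := weightLT_twistedMultiDeriv hP hp i 0
  rw [length_coe_zero, zero_add, coeff_sub, coeff_C, if_pos rfl] at h
  convert h using 2
  ext x
  have hi : (multiFactorial i : ℂ) ≠ 0 :=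
    Nat.cast_ne_zero.2 (Finset.prod_ne_zero_iff.2 fun k _ => Nat.factorial_ne_zero _)
  rw [taylor_polyExp, mul_div_cancel₀ _ hi, ← map_twistedMultiDeriv, coeff_map]
  · rfl
  · rw [coeff_map, hP0, map_zero]

/-! ## The generalized plane waves as products of a polynomial and an exponential -/

/-- The polynomial with coefficients `a_i`, `|i| ≤ d`. -/
def coeffPoly {A : Type*} [CommRing A] (d : ℕ) (a : MultiIndex → A) : MvPolynomial (Fin 3) A :=
  ∑ i ∈ indicesUpTo d, monomial (Finsupp.equivFunOnFinite.symm i) (a i)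

theorem mem_indicesUpTo {d : ℕ} {i : MultiIndex} : i ∈ indicesUpTo d ↔ length i ≤ d := by
  simp only [indicesUpTo, Finset.mem_filter, Finset.mem_Iic, and_iff_right_iff_imp]
  exact fun h k => (Finset.single_le_sum (fun _ _ => Nat.zero_le _) (Finset.mem_univ k)).trans h

theorem coeff_coeffPoly {A : Type*} [CommRing A] (d : ℕ) (a : MultiIndex → A) (m : Fin 3 →₀ ℕ) :
    coeff m (coeffPoly d a) = if length m ≤ d then a m else 0 := by
  simp only [coeffPoly, coeff_sum, coeff_monomial, Equiv.symm_apply_eq, Finsupp.equivFunOnFinite]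
  simp [mem_indicesUpTo]

theorem map_coeffPoly {A B : Type*} [CommRing A] [CommRing B] (f : A →+* B) (d : ℕ)
    (a : MultiIndex → A) : map f (coeffPoly d a) = coeffPoly d fun i => f (a i) := by
  simp [coeffPoly, map_sum, map_monomial]

theorem evalAt_coeffPoly (xC : Space) (d : ℕ) (a : MultiIndex → ℂ) (x : Space) :
    evalAt xC (coeffPoly d a) x = polyFun d a (x - xC) := by
  simp [evalAt, coeffPoly, polyFun, eval_monomial, Finsupp.prod_fintype]

variable {xC : Space} {c : MultiIndex → Space → ℂ} {z : ℂ}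

theorem taylor_amplitudeGPW_mem (hz : ∀ x, principalSymbol xC c (Λ x) = z) (q : ℕ)
    (i : MultiIndex) :
    (fun x => multiFactorial i * taylor xC (amplitudeGPW xC c q (Λ x)) i) - paramMonomial Λ i
      ∈ degreeLT Λ (length i) := by
  let P : MvPolynomial (Fin 3) (ι → ℂ) := ∑ k, C (fun x => Λ x k) * X k
  let Q : MvPolynomial (Fin 3) (ι → ℂ) :=
    coeffPoly (q + 1) fun i x => amplitudeCoeffs xC c (Λ x) q i
  have h := taylor_polyExp_mem (Λ := Λ) (P := P) (p := Q) xC (by simp [P, coeff_sum]) ?_ ?_ i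
  · convert h using 6 with x
    ext y
    simp only [P, Q, polyExp, amplitudeGPW, map_coeffPoly, evalAt_coeffPoly, Pi.evalRingHom_apply]
    simp [evalAt]
  · intro k
    have : pderiv k P = C fun x => Λ x k := by
      simp only [P, map_sum, pderiv_C_mul, pderiv_X]
      rw [Finset.sum_eq_single k]
      · simp
      · intro b _ hb
        simp [hb]
      · simp
    rw [this, sub_self]
    intro m
    rw [coeff_zero]
    exact zero_mem _
  · intro m
    rw [coeff_sub, coeff_coeffPoly, coeff_one, add_zero]
    rcases eq_or_ne m 0 with rfl | hm
    · simp only [if_true, Finsupp.coe_zero, amplitudeCoeffs_zero, length_zero, zero_le]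
      -- `degreeLT Λ 0` is the zero space, so the normalization `μ_0 = 1` is needed exactly.
      exact (sub_self (1 : ι → ℂ)).symm ▸ zero_mem (degreeLT Λ 0)
    · rw [if_neg hm.symm, sub_zero]
      split_ifs
      · exact amplitudeCoeffs_mem hz q m fun h0 => hm (DFunLike.coe_injective h0)
      · exact zero_mem _

theorem taylor_phaseGPW_mem (hz : ∀ x, principalSymbol xC c (Λ x) = z) (q : ℕ)
    (i : MultiIndex) :
    (fun x => multiFactorial i * taylor xC (phaseGPW xC c q (Λ x)) i) - paramMonomial Λ i
      ∈ degreeLT Λ (length i) := by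
  let P : MvPolynomial (Fin 3) (ι → ℂ) :=
    coeffPoly (q + 1) fun i x => phaseCoeffs xC c (Λ x) q i
  have hP0 : coeff 0 P = 0 := by
    rw [coeff_coeffPoly]
    simp only [Finsupp.coe_zero, phaseCoeffs_zero]
    exact ite_self _
  have h := taylor_polyExp_mem (Λ := Λ) (P := P) (p := 1) xC hP0 ?_ ?_ i
  · convert h using 6 with x
    ext y
    simp only [P, polyExp, phaseGPW, map_coeffPoly, evalAt_coeffPoly, Pi.evalRingHom_apply]
    simp [evalAt]
  · intro k m
    have hs : ⇑(m + Finsupp.single k 1 : Fin 3 →₀ ℕ) = (⇑m + e k : MultiIndex) := by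
      rw [Finsupp.coe_add, Finsupp.single_eq_pi_single, e]
    rw [coeff_sub, coeff_pderiv, coeff_C, coeff_coeffPoly, hs, length_add, length_e]
    -- The constant term of `∂_k P` is exactly `Λ_k` and cancels; the other coefficients involve
    -- `λ_i` with `|i| ≥ 2`.
    rcases eq_or_ne m 0 with rfl | hm
    · simp only [Finsupp.coe_zero, zero_add, phaseCoeffs_e, length_zero]
      convert zero_mem (degreeLT Λ 1) using 1
      simp
    · rw [if_neg hm.symm, sub_zero]
      have hm : 0 < length m := length_pos fun h0 => hm (DFunLike.coe_injective h0)
      split_ifs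
      · have h := phaseCoeffs_mem hz q (⇑m + e k) (by rw [length_add, length_e]; omega)
        rw [length_add, length_e] at h
        convert (degreeLT Λ _).smul_mem (m k + 1 : ℂ) h using 1
        ext x
        simp [mul_comm]
      · rw [zero_mul]
        exact zero_mem _
  · intro m
    rw [sub_self, coeff_zero]
    exact zero_mem _

end Derivatives

/-! ## The rank of a matrix of Taylor coefficients -/

section Rank

variable {ι : Type} [Fintype ι] {Λ : ι → Fin 3 → ℂ} {xC : Space}

theorem rank_taylorMatrix (n : ℕ) (b : ι → Space → ℂ)
    (hb : ∀ i, (fun x => multiFactorial i * taylor xC (b x) i) - paramMonomial Λ i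
      ∈ degreeLT Λ (length i))
    (hsep : ∀ v : ι → ℂ, (∀ g ∈ degreeLT Λ (n + 1), ∑ x, g x * v x = 0) → v = 0) :
    (taylorMatrix xC n b).rank = Fintype.card ι := by
  have hinj : Function.Injective (taylorMatrix xC n b).mulVecLin := by
    rw [← LinearMap.ker_eq_bot, LinearMap.ker_eq_bot']
    intro v hv
    -- `K` is the space of functions orthogonal to `v`; it contains the rows, hence, degree by
    -- degree, all monomials of degree at most `n`.
    let K : Submodule ℂ (ι → ℂ) := LinearMap.ker (∑ x, v x • LinearMap.proj (R := ℂ) (φ := fun _ : ι => ℂ) x)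
    have hK : ∀ g, g ∈ K ↔ ∑ x, g x * v x = 0 := by
      intro g
      simp [K, mul_comm]
    have hrow : ∀ i, length i ≤ n → (fun x => multiFactorial i * taylor xC (b x) i) ∈ K := by
      intro i hi
      have h := congrFun hv ⟨i, mem_indicesUpTo.2 hi⟩
      simp only [Matrix.mulVecLin_apply, Matrix.mulVec, dotProduct, taylorMatrix, Matrix.of_apply,
        Pi.zero_apply] at h
      rw [hK]
      simp only [mul_assoc, ← Finset.mul_sum, h, mul_zero]
    have hle : ∀ d ≤ n + 1, degreeLT Λ d ≤ K := by
      intro d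
      induction d with
      | zero =>
        intro _
        refine Submodule.span_le.2 ?_
        rintro _ ⟨m, hm, rfl⟩
        omega
      | succ d ih =>
        intro hd
        refine Submodule.span_le.2 ?_
        rintro _ ⟨m, hm, rfl⟩
        have h := sub_mem (hrow m (by omega))
          (ih (by omega) (degreeLT_mono (by omega) (hb m)))
        rwa [sub_sub_cancel] at h
    exact hsep v fun g hg => (hK g).1 (hle _ le_rfl hg)
  rw [Matrix.rank, LinearMap.finrank_range_of_inj hinj, Module.finrank_fintype_fun_eq_card]

end Rank

/-! ## Polynomials separating the points of parallel circles -/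

section Separation

variable {ι : Type} {Λ : ι → Fin 3 → ℂ}

theorem prod_mem_degreeLT {κ : Type*} (s : Finset κ) (f : κ → ι → ℂ)
    (hf : ∀ a ∈ s, f a ∈ degreeLT Λ 2) :
    (fun x => ∏ a ∈ s, f a x) ∈ degreeLT Λ (s.card + 1) := by
  classical
  induction s using Finset.induction_on with
  | empty => simpa using const_mem_degreeLT (Λ := Λ) 1 one_pos
  | insert a s ha ih =>
    simp only [Finset.prod_insert ha, Finset.card_insert_of_notMem ha]
    exact mul_mem_degreeLT' (a := 1) (hf a (Finset.mem_insert_self _ _))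
      (ih fun b hb => hf b (Finset.mem_insert_of_mem hb)) (by omega)

/-- Three distinct points of a circle centred at the origin are not collinear. -/
theorem circle_not_collinear {r x₀ y₀ x₁ y₁ x₂ y₂ : ℝ} (h₀ : x₀ ^ 2 + y₀ ^ 2 = r)
    (h₁ : x₁ ^ 2 + y₁ ^ 2 = r) (h₂ : x₂ ^ 2 + y₂ ^ 2 = r) (h₀₁ : ¬(x₀ = x₁ ∧ y₀ = y₁))
    (h₀₂ : ¬(x₀ = x₂ ∧ y₀ = y₂)) (h₁₂ : ¬(x₁ = x₂ ∧ y₁ = y₂)) :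
    (x₀ - x₁) * (y₂ - y₁) - (y₀ - y₁) * (x₂ - x₁) ≠ 0 := by
  intro h
  obtain ⟨u, hu⟩ : ∃ u, u = x₀ - x₁ := ⟨_, rfl⟩
  obtain ⟨v, hv⟩ : ∃ v, v = y₀ - y₁ := ⟨_, rfl⟩
  have hN : 0 < u ^ 2 + v ^ 2 := by
    have : u ≠ 0 ∨ v ≠ 0 := by
      by_contra! hc
      exact h₀₁ ⟨by linarith [hc.1], by linarith [hc.2]⟩
    rcases this with h | h <;> positivity
  -- Collinearity puts the third point at parameter `t` on the line with the second point at 0 and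
  -- the first at 1. On the circle `t` solves a quadratic equation with roots 0 and 1.
  obtain ⟨t, ht⟩ : ∃ t, t = ((x₂ - x₁) * u + (y₂ - y₁) * v) / (u ^ 2 + v ^ 2) := ⟨_, rfl⟩
  have ht' : t * (u ^ 2 + v ^ 2) = (x₂ - x₁) * u + (y₂ - y₁) * v := by
    rw [ht]
    field_simp
  rw [← hu, ← hv] at h
  have hx : x₂ = x₁ + t * u := by
    have : (u ^ 2 + v ^ 2) * (x₂ - (x₁ + t * u)) = 0 := by
      linear_combination -v * h - u * ht'
    rcases mul_eq_zero.1 this with h | h <;> linarith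
  have hy : y₂ = y₁ + t * v := by
    have : (u ^ 2 + v ^ 2) * (y₂ - (y₁ + t * v)) = 0 := by
      linear_combination u * h - v * ht'
    rcases mul_eq_zero.1 this with h | h <;> linarith
  have hx₀ : x₀ = x₁ + u := by linarith
  have hy₀ : y₀ = y₁ + v := by linarith
  have key : t * (t - 1) * (u ^ 2 + v ^ 2) = 0 := by
    subst hx hy hx₀ hy₀
    linear_combination h₂ - t * h₀ - (1 - t) * h₁
  rcases mul_eq_zero.1 key with h | h
  · rcases mul_eq_zero.1 h with h | h
    · exact h₁₂ ⟨by rw [hx, h]; ring, by rw [hy, h]; ring⟩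
    · have : t = 1 := by linarith
      exact h₀₂ ⟨by rw [hx, hx₀, this]; ring, by rw [hy, hy₀, this]; ring⟩
  · exact hN.ne' h

/-- Pair up the `2l` points and multiply the equations of the `l` chords; no chord line meets the
circle in a third point, so none contains `p`. -/
theorem exists_separating_on_circle {X Y : ι → ℝ} (hX : (fun a => (X a : ℂ)) ∈ degreeLT Λ 2)
    (hY : (fun a => (Y a : ℂ)) ∈ degreeLT Λ 2) (r : ℝ) (p : ι) (hp : X p ^ 2 + Y p ^ 2 = r)
    (l : ℕ) : ∀ S : Finset ι, S.card = 2 * l → (∀ a ∈ S, X a ^ 2 + Y a ^ 2 = r) →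
      (∀ a ∈ S, ¬(X p = X a ∧ Y p = Y a)) →
      (∀ a ∈ S, ∀ b ∈ S, a ≠ b → ¬(X a = X b ∧ Y a = Y b)) →
      ∃ g ∈ degreeLT Λ (l + 1), g p ≠ 0 ∧ ∀ a ∈ S, g a = 0 := by
  classical
  induction l with
  | zero =>
    intro S hS _ _ _
    refine ⟨_, const_mem_degreeLT 1 one_pos, one_ne_zero, fun a ha => ?_⟩
    rw [Finset.card_eq_zero.1 hS] at ha
    simp at ha
  | succ l ih =>
    intro S hS hr hpS hSS
    obtain ⟨a, ha, b, hb, hab⟩ := Finset.one_lt_card.1 (show 1 < S.card by omega)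
    have hbS : b ∈ S.erase a := Finset.mem_erase.2 ⟨hab.symm, hb⟩
    have hsub : (S.erase a).erase b ⊆ S := (Finset.erase_subset _ _).trans (Finset.erase_subset _ _)
    obtain ⟨g, hg, hgp, hgS⟩ := ih ((S.erase a).erase b)
      (by rw [Finset.card_erase_of_mem hbS, Finset.card_erase_of_mem ha]; omega)
      (fun x hx => hr x (hsub hx)) (fun x hx => hpS x (hsub hx))
      (fun x hx y hy => hSS x (hsub hx) y (hsub hy))
    let f : ι → ℂ := fun x =>
      ((Y b - Y a : ℝ) : ℂ) * (X x - X a) - ((X b - X a : ℝ) : ℂ) * (Y x - Y a)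
    have hf : f ∈ degreeLT Λ (1 + 1) := sub_mem
      (const_mul_mem_degreeLT _ (sub_mem hX (const_mem_degreeLT _ two_pos)))
      (const_mul_mem_degreeLT _ (sub_mem hY (const_mem_degreeLT _ two_pos)))
    refine ⟨fun x => f x * g x, mul_mem_degreeLT' hf hg (by omega), mul_ne_zero ?_ hgp,
      fun x hx => ?_⟩
    · have h := circle_not_collinear hp (hr a ha) (hr b hb) (hpS a ha) (hpS b hb)
        (hSS a ha b hb hab)
      intro h0
      apply h
      have h0' : ((Y b - Y a) * (X p - X a) - (X b - X a) * (Y p - Y a) : ℝ) = 0 := by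
        apply Complex.ofReal_injective
        simpa [f] using h0
      linarith
    · rcases eq_or_ne x a with rfl | hxa
      · simp [f]
      rcases eq_or_ne x b with rfl | hxb
      · simp only [f]
        push_cast
        ring
      · simp [hgS x (Finset.mem_erase.2 ⟨hxb, Finset.mem_erase.2 ⟨hxa, hx⟩⟩)]

end Separation

theorem cos_sin_ne {a b : ℝ} (ha : a ∈ Set.Ico 0 (2 * Real.pi)) (hb : b ∈ Set.Ico 0 (2 * Real.pi))
    (hab : a ≠ b) : ¬(Real.cos a = Real.cos b ∧ Real.sin a = Real.sin b) := by
  rintro ⟨hc, hs⟩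
  obtain ⟨k, hk⟩ := Real.Angle.angle_eq_iff_two_pi_dvd_sub.1 (Real.Angle.cos_sin_inj hc hs)
  have hpi := Real.pi_pos
  have h1 : (k : ℝ) < 1 := by nlinarith [ha.2, hb.1]
  have h2 : (-1 : ℝ) < k := by nlinarith [ha.1, hb.2]
  have h1' : k < 1 := by exact_mod_cast h1
  have h2' : -1 < k := by exact_mod_cast h2
  have : k = 0 := by omega
  rw [this] at hk
  simp only [Int.cast_zero, mul_zero] at hk
  exact hab (sub_eq_zero.1 hk)

/-! ### Separation of the directions in degree `n` -/

section Directions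

variable {n : ℕ} {θ : Fin (n + 1) → ℝ} {φ : DirectionIndex n → ℝ}
  {Λ : DirectionIndex n → Fin 3 → ℂ}

theorem exists_separating (hθ : ∀ l, θ l ∈ Set.Ioo 0 Real.pi)
    (hθ_inj : ∀ l l', l ≠ l' → θ l ≠ θ l') (hφ : ∀ j, φ j ∈ Set.Ico 0 (2 * Real.pi))
    (hφ_inj : ∀ l m m', m ≠ m' → φ ⟨l, m⟩ ≠ φ ⟨l, m'⟩)
    (hΛ : ∀ k, (fun j => (direction (θ j.1) (φ j) k : ℂ)) ∈ degreeLT Λ 2) (p : DirectionIndex n) :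
    ∃ g ∈ degreeLT Λ (n + 1), g p ≠ 0 ∧ ∀ j, p.1 ≤ j.1 → j ≠ p → g j = 0 := by
  classical
  obtain ⟨l, m⟩ := p
  have hsin : Real.sin (θ l) ≠ 0 := (Real.sin_pos_of_mem_Ioo (hθ l)).ne'
  have hcirc : ∀ m', direction (θ l) (φ ⟨l, m'⟩) 0 ^ 2 + direction (θ l) (φ ⟨l, m'⟩) 1 ^ 2
      = Real.sin (θ l) ^ 2 := by
    intro m'
    simp only [direction, Matrix.cons_val_zero, Matrix.cons_val_one]
    linear_combination Real.sin (θ l) ^ 2 * Real.sin_sq_add_cos_sq (φ ⟨l, m'⟩)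
  have hdist : ∀ m₁ m₂, m₁ ≠ m₂ →
      ¬(direction (θ l) (φ ⟨l, m₁⟩) 0 = direction (θ l) (φ ⟨l, m₂⟩) 0 ∧
        direction (θ l) (φ ⟨l, m₁⟩) 1 = direction (θ l) (φ ⟨l, m₂⟩) 1) := by
    intro m₁ m₂ h
    simp only [direction, Matrix.cons_val_zero, Matrix.cons_val_one, mul_right_inj' hsin]
    exact cos_sin_ne (hφ _) (hφ _) (hφ_inj l m₁ m₂ h)
  have hinj : Function.Injective fun m' => (⟨l, m'⟩ : DirectionIndex n) :=
    fun a b h => eq_of_heq (Sigma.mk.inj h).2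
  obtain ⟨g, hg, hgp, hgS⟩ := exists_separating_on_circle (hΛ 0) (hΛ 1) (Real.sin (θ l) ^ 2)
    -- Circle `l` carries `2l + 1` directions, so exactly `2l` remain: `l` pairs.
    ⟨l, m⟩ (hcirc m) l ((Finset.univ.erase m).image fun m' => ⟨l, m'⟩) (by
      rw [Finset.card_image_of_injective _ hinj, Finset.card_erase_of_mem (Finset.mem_univ _),
        Finset.card_univ, Fintype.card_coe, Int.card_Icc]
      omega) (by
      intro a ha
      obtain ⟨m', _, rfl⟩ := Finset.mem_image.1 ha
      exact hcirc m') (by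
      intro a ha
      obtain ⟨m', hm', rfl⟩ := Finset.mem_image.1 ha
      exact hdist m m' (Finset.ne_of_mem_erase hm').symm) (by
      intro a ha b hb hab
      obtain ⟨m₁, _, rfl⟩ := Finset.mem_image.1 ha
      obtain ⟨m₂, _, rfl⟩ := Finset.mem_image.1 hb
      exact hdist m₁ m₂ fun h => hab (by rw [h]))
  -- One horizontal plane for each of the `n - l` circles of larger index.
  have hf := prod_mem_degreeLT (Finset.Ioi l)
    (fun l' j => (direction (θ j.1) (φ j) 2 : ℂ) - (Real.cos (θ l') : ℂ))
    fun l' _ => sub_mem (hΛ 2) (const_mem_degreeLT _ two_pos)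
  refine ⟨_, mul_mem_degreeLT' hf hg ?_, mul_ne_zero ?_ hgp, ?_⟩
  · rw [Fin.card_Ioi]
    have := l.2
    omega
  · refine Finset.prod_ne_zero_iff.2 fun l' hl' => ?_
    rw [sub_ne_zero, Ne, Complex.ofReal_inj]
    exact fun h => hθ_inj l l' (Finset.mem_Ioi.1 hl').ne (Real.injOn_cos
      (Set.Ioo_subset_Icc_self (hθ l)) (Set.Ioo_subset_Icc_self (hθ l')) h)
  · rintro ⟨l', m'⟩ hl hne
    rcases eq_or_lt_of_le hl with h | h
    · change l = l' at h
      subst h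
      refine mul_eq_zero_of_right _ (hgS _ (Finset.mem_image_of_mem _ (Finset.mem_erase.2
        ⟨fun h => hne (by rw [h]), Finset.mem_univ _⟩)))
    · exact mul_eq_zero_of_left (Finset.prod_eq_zero (Finset.mem_Ioi.2 h)
        (by simp [direction])) _

/-- Induction on `l`: in the relation for the `g` attached to `p`, smaller indices drop out because
`v` vanishes there, all other terms because `g` does. -/
theorem eq_zero_of_orthogonal_degreeLT
    (hsep : ∀ p : DirectionIndex n,
      ∃ g ∈ degreeLT Λ (n + 1), g p ≠ 0 ∧ ∀ j, p.1 ≤ j.1 → j ≠ p → g j = 0)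
    (v : DirectionIndex n → ℂ) (hv : ∀ g ∈ degreeLT Λ (n + 1), ∑ j, g j * v j = 0) : v = 0 := by
  have h : ∀ l : Fin (n + 1), ∀ m, v ⟨l, m⟩ = 0 := by
    intro l
    induction l using WellFoundedLT.induction with
    | _ l ih =>
      intro m
      obtain ⟨g, hg, hgp, hg0⟩ := hsep ⟨l, m⟩
      have h := hv g hg
      rw [Finset.sum_eq_single ⟨l, m⟩ _ (by simp)] at h
      · exact (mul_eq_zero.1 h).resolve_left hgp
      · rintro ⟨l', m'⟩ _ hne
        rcases lt_or_ge l' l with hl | hl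
        · rw [ih l' hl m', mul_zero]
        · rw [hg0 _ hl hne, zero_mul]
  ext ⟨l, m⟩
  exact h l m

end Directions

/-! ## The linear parameters -/

section LinearParam

variable {P : Matrix (Fin 3) (Fin 3) ℝ} {D : Fin 3 → ℝ} {R : Fin 3 → ℂ} {s : ℂ}

theorem map_transpose_mul_self (hP : P ∈ Matrix.orthogonalGroup (Fin 3) ℝ) :
    (P.map Complex.ofReal).transpose * P.map Complex.ofReal = 1 := by
  have h := (Matrix.mem_orthogonalGroup_iff' _ _).1 hP
  have h' := congrArg (fun M : Matrix (Fin 3) (Fin 3) ℝ => M.map Complex.ofRealHom) h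
  simp only [Matrix.map_mul, Matrix.map_one _ (map_zero _) (map_one _)] at h'
  exact h'

/-- The map from `d` to `Λ` is linear and invertible: `Pᵀ Λ = s R d`. -/
theorem direction_mem_degreeLT {ι : Type} (hP : P ∈ Matrix.orthogonalGroup (Fin 3) ℝ)
    (hR : ∀ k, R k ≠ 0) (hs : s ≠ 0) (d : ι → Fin 3 → ℝ) (k : Fin 3) :
    (fun j => (d j k : ℂ)) ∈ degreeLT (fun j => linearParam s P R (d j)) 2 := by
  have h : (fun j => (d j k : ℂ)) = fun j =>
      (s * R k)⁻¹ * ∑ a, (P a k : ℂ) * linearParam s P R (d j) a := by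
    ext j
    have h1 : ((P.map Complex.ofReal).transpose.mulVec (linearParam s P R (d j))) k =
        s * (R k * d j k) := by
      rw [linearParam, Matrix.mulVec_smul, Matrix.mulVec_mulVec, ← Matrix.mul_assoc,
        map_transpose_mul_self hP, Matrix.one_mul, Pi.smul_apply, Matrix.mulVec_diagonal,
        smul_eq_mul]
    have h2 : ∑ a, (P a k : ℂ) * linearParam s P R (d j) a = s * (R k * d j k) := h1
    rw [h2]
    field_simp [hR k, hs]
  rw [h]
  exact const_mul_mem_degreeLT _ (sum_mem_degreeLT fun a _ =>
    const_mul_mem_degreeLT _ (param_mem_degreeLT a one_lt_two))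

theorem taylor_zero (xC : Space) (f : Space → ℂ) : taylor xC f 0 = f xC := by
  simp [taylor, multiDeriv, multiFactorial]

theorem principalSymbol_eq (xC : Space) (c : MultiIndex → Space → ℂ) (Λ : Fin 3 → ℂ) :
    principalSymbol xC c Λ = Λ ⬝ᵥ (principalMatrix xC c).mulVec Λ := by
  have h0 : Finset.Ioi (0 : Fin 3) = {1, 2} := by decide
  have h1 : Finset.Ioi (1 : Fin 3) = {2} := by decide
  have h2 : Finset.Ioi (2 : Fin 3) = ∅ := by decide
  simp only [principalSymbol, taylor_zero, dotProduct, Matrix.mulVec, principalMatrix,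
    Matrix.of_apply, Fin.sum_univ_three, h0, h1, h2, Finset.sum_empty, Finset.sum_singleton,
    Finset.sum_pair (show (1 : Fin 3) ≠ 2 by decide), Fin.reduceEq, if_true, if_false,
    add_comm (e 1) (e 0), add_comm (e 2) (e 0), add_comm (e 2) (e 1)]
  ring

/-- Orthogonality of `P` and `R² D = 1` reduce the form to `s² (d · d)`, a bilinear product without
conjugation, and `d` is a real unit vector. -/
theorem principalSymbol_linearParam {xC : Space} {c : MultiIndex → Space → ℂ}
    (hPD : IsEigenDecomposition xC c P D) (hR : ∀ k, R k ^ 2 = ((D k : ℂ))⁻¹) (θ φ : ℝ) :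
    principalSymbol xC c (linearParam s P R (direction θ φ)) = s ^ 2 := by
  have hM : principalMatrix xC c = P.map Complex.ofReal *
      Matrix.diagonal (fun k => (D k : ℂ)) * (P.map Complex.ofReal).transpose := by
    rw [hPD.eq]
    have h := Matrix.map_mul (L := P * Matrix.diagonal D) (M := P.transpose)
      (f := Complex.ofRealHom)
    have h' := Matrix.map_mul (L := P) (M := Matrix.diagonal D) (f := Complex.ofRealHom)
    have hd : (Matrix.diagonal D).map Complex.ofRealHom =
        Matrix.diagonal fun k => (D k : ℂ) := by
      rw [Matrix.diagonal_map (map_zero _)]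
      rfl
    rw [h', hd] at h
    exact h
  have hPP := map_transpose_mul_self hPD.orthogonal
  rw [principalSymbol_eq, hM, linearParam, Matrix.mulVec_smul, Matrix.mulVec_mulVec]
  set Q := P.map Complex.ofReal
  rw [show Q * Matrix.diagonal (fun k => (D k : ℂ)) * Q.transpose * (Q * Matrix.diagonal R) =
      Q * (Matrix.diagonal (fun k => (D k : ℂ)) * Matrix.diagonal R) by
    rw [Matrix.mul_assoc, ← Matrix.mul_assoc Q.transpose, hPP, Matrix.one_mul, Matrix.mul_assoc],
    ← Matrix.mulVec_mulVec, ← Matrix.mulVec_mulVec, smul_dotProduct, dotProduct_smul,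
    Matrix.dotProduct_mulVec, Matrix.vecMul_mulVec, hPP, Matrix.vecMul_one]
  have hRD : ∀ k, D k * R k ^ 2 = 1 := fun k => by
    rw [hR, mul_inv_cancel₀ (Complex.ofReal_ne_zero.2 (hPD.diag_ne_zero k))]
  have hd : ((direction θ φ 0 : ℝ) : ℂ) ^ 2 + (direction θ φ 1 : ℝ) ^ 2 + (direction θ φ 2 : ℝ) ^ 2
      = 1 := by
    norm_cast
    simp only [direction, Matrix.cons_val_zero, Matrix.cons_val_one, Matrix.cons_val_two,
      Matrix.tail_cons, Matrix.head_cons]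
    linear_combination Real.sin θ ^ 2 * Real.sin_sq_add_cos_sq φ + Real.sin_sq_add_cos_sq θ
  simp only [dotProduct, Matrix.diagonal_mul_diagonal, Matrix.mulVec_diagonal, Fin.sum_univ_three,
    smul_eq_mul]
  linear_combination s ^ 2 * hd + s ^ 2 * (direction θ φ 0 : ℂ) ^ 2 * hRD 0 +
    s ^ 2 * (direction θ φ 1 : ℂ) ^ 2 * hRD 1 + s ^ 2 * (direction θ φ 2 : ℂ) ^ 2 * hRD 2

end LinearParam

/-! ## Cardinalities -/

theorem card_indicesUpTo (n : ℕ) :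
    Fintype.card (indicesUpTo n) = (n + 1) * (n + 2) * (n + 3) / 6 := by
  have hdisj : ((Finset.range (n + 1) : Finset ℕ) : Set ℕ).PairwiseDisjoint
      fun d => Finset.piAntidiag (Finset.univ : Finset (Fin 3)) d := by
    intro a _ b _ hab
    refine Finset.disjoint_left.2 fun i hi hi' => hab ?_
    rw [← (Finset.mem_piAntidiag.1 hi).1, (Finset.mem_piAntidiag.1 hi').1]
  have h : indicesUpTo n = (Finset.range (n + 1)).disjiUnion
      (fun d => Finset.piAntidiag (Finset.univ : Finset (Fin 3)) d) hdisj := by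
    ext i
    simp [mem_indicesUpTo, length]
  have hcard : ∀ d, (Finset.piAntidiag (Finset.univ : Finset (Fin 3)) d).card =
      Nat.multichoose 3 d := by
    intro d
    have h := Finset.card_finsuppAntidiag_nat_eq_multichoose (s := (Finset.univ : Finset (Fin 3))) d
    rwa [Finset.finsuppAntidiag, Finset.card_map, Finset.card_attach, Finset.card_univ,
      Fintype.card_fin] at h
  rw [Fintype.card_coe, h, Finset.card_disjiUnion]
  simp only [hcard]
  rw [Nat.sum_range_multichoose, Nat.choose_eq_descFactorial_div_factorial]
  simp only [Nat.descFactorial, Nat.factorial]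
  congr 1
  simp only [Nat.sub_zero, show n + 3 - 1 = n + 2 by omega,
    show n + 3 - 2 = n + 1 by omega]
  ring

theorem card_directionIndex (n : ℕ) : Fintype.card (DirectionIndex n) = (n + 1) ^ 2 := by
  have h : ∀ l : ℕ, Fintype.card (Finset.Icc (-(l : ℤ)) (l : ℤ)) = 2 * l + 1 := by
    intro l
    rw [Fintype.card_coe, Int.card_Icc]
    omega
  rw [Fintype.card_sigma]
  simp only [h]
  rw [Fin.sum_univ_eq_sum_range (fun l => 2 * l + 1)]
  induction n with
  | zero => rfl
  | succ n ih => rw [Finset.sum_range_succ, ih]; ring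

end GPW

end

/-! ### The rank theorem -/

theorem mainTheorem3 (n : ℕ) (hn : 1 ≤ n) (xC : GPW.Space)
    (c : GPW.MultiIndex → GPW.Space → ℂ) (hc : GPW.OperatorHypothesis xC c)
    (P : Matrix (Fin 3) (Fin 3) ℝ) (D : Fin 3 → ℝ) (hPD : GPW.IsEigenDecomposition xC c P D)
    (R : Fin 3 → ℂ) (hR : ∀ k, R k ^ 2 = ((D k : ℂ))⁻¹)
    (s : ℂ) (hs : s ≠ 0)
    (θ : Fin (n + 1) → ℝ) (hθ : ∀ l, θ l ∈ Set.Ioo 0 Real.pi)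
    (hθ_inj : ∀ l l', l ≠ l' → θ l ≠ θ l')
    (φ : GPW.DirectionIndex n → ℝ) (hφ : ∀ j, φ j ∈ Set.Ico 0 (2 * Real.pi))
    (hφ_inj : ∀ l m m', m ≠ m' → φ ⟨l, m⟩ ≠ φ ⟨l, m'⟩) :
    Fintype.card (GPW.indicesUpTo n) = (n + 1) * (n + 2) * (n + 3) / 6 ∧
    Fintype.card (GPW.DirectionIndex n) = (n + 1) ^ 2 ∧
    (GPW.taylorMatrix xC n fun j : GPW.DirectionIndex n =>
        GPW.amplitudeGPW xC c (max (n - 1) 1)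
          (GPW.linearParam s P R (GPW.direction (θ j.1) (φ j)))).rank = (n + 1) ^ 2 ∧
    (GPW.taylorMatrix xC n fun j : GPW.DirectionIndex n =>
        GPW.phaseGPW xC c (max (n - 1) 1)
          (GPW.linearParam s P R (GPW.direction (θ j.1) (φ j)))).rank = (n + 1) ^ 2 := by
  have hR0 : ∀ k, R k ≠ 0 := fun k h => by
    have h' := hR k
    rw [h, zero_pow two_ne_zero, eq_comm, inv_eq_zero, Complex.ofReal_eq_zero] at h'
    exact hPD.diag_ne_zero k h'
  have hz : ∀ j : GPW.DirectionIndex n, GPW.principalSymbol xC c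
      (GPW.linearParam s P R (GPW.direction (θ j.1) (φ j))) = s ^ 2 :=
    fun j => GPW.principalSymbol_linearParam hPD hR _ _
  have hdir := GPW.direction_mem_degreeLT hPD.orthogonal hR0 hs
    fun j : GPW.DirectionIndex n => GPW.direction (θ j.1) (φ j)
  have hsep := GPW.eq_zero_of_orthogonal_degreeLT
    fun p => GPW.exists_separating hθ hθ_inj hφ hφ_inj hdir p
  refine ⟨GPW.card_indicesUpTo n, GPW.card_directionIndex n, ?_, ?_⟩
  · exact (GPW.rank_taylorMatrix n _ (GPW.taylor_amplitudeGPW_mem hz _) hsep).trans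
      (GPW.card_directionIndex n)
  · exact (GPW.rank_taylorMatrix n _ (GPW.taylor_phaseGPW_mem hz _) hsep).trans
      (GPW.card_directionIndex n)
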